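/- For a prime power $q$, let $\mathrm{PG}(N,q)$ be the $N$-dimensional projective space over the field with $q$ elements. A set $\mathcal S$ of points of $\mathrm{PG}(N,q)$ is called saturating if every point of $\mathrm{PG}(N,q)\setminus\mathcal S$ is collinear with two distinct points of $\mathcal S$; let $s(N,q)$ be the smallest size of a saturating set in $\mathrm{PG}(N,q)$. Let $\ell(R,r,q)$ be the smallest length of a $q$-ary linear code with covering radius $R$ and codimension $r$, where the covering radius is the least integer $R$ such that every vector is at Hamming distance at most $R$ from some codeword. Put $$\Upsilon(q)=\sqrt{(q+1)\left(3\ln q+\ln\ln q+\ln\tfrac34\right)}+\sqrt{\frac{q}{3\ln q}}+3 .$$ Let $q\ge 79$ be a prime power. (i) For every even $N=2t-2\ge 4$ with $N\ne 8,12$ (that is, $t=3,4,6$ or $t\ge 8$), $$s(N,q)=\ell(2,N+1,q)\le \Upsilon(q)\,q^{\frac{N-2}{2}}+2q^{\frac{N-4}{2}} .$$ (ii) For $N=8$ and $N=12$, $$s(N,q)=\ell(2,N+1,q)\le \Upsilon(q)\,q^{\frac{N-2}{2}}+2q^{\frac{N-4}{2}}+q^{\frac{N-6}{2}}+q^{\frac{N-8}{2}}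 .$$ -/

import Mathlib

open scoped LinearAlgebra.Projectivization

/-- The projective space `PG(N, q)` over the field `F` (with `q = |F|`). -/
abbrev PG (N : ℕ) (F : Type*) [Field F] : Type _ := ℙ F (Fin (N + 1) → F)

/-- A set `S` of points of `PG(N, q)` is saturating if every point outside `S` is collinear with
two (distinct) points of `S`. -/
def IsSaturating {N : ℕ} {F : Type*} [Field F] (S : Set (PG N F)) : Prop :=
  ∀ P : PG N F, P ∉ S →
    ∃ A ∈ S, ∃ B ∈ S, A ≠ B ∧ Projectivization.IsCollinear {P, A, B}

/-- `s(N, q)`: the smallest size of a saturating set in `PG(N, q)`. -/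
noncomputable def saturatingNumber (N : ℕ) (F : Type*) [Field F] : ℕ :=
  sInf {n : ℕ | ∃ S : Finset (PG N F), IsSaturating (S : Set (PG N F)) ∧ S.card = n}

/-- The minimum defining `s(N, q)` is attained, since the whole space is saturating. -/
theorem saturatingNumber_attained (N : ℕ) (F : Type*) [Field F] [Finite F] :
    ∃ S : Finset (PG N F),
      IsSaturating (S : Set (PG N F)) ∧ S.card = saturatingNumber N F := by
  have hne : {n : ℕ | ∃ S : Finset (PG N F),
      IsSaturating (S : Set (PG N F)) ∧ S.card = n}.Nonempty := by
    haveI : Finite (PG N F) := Quotient.finite _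
    haveI := Fintype.ofFinite (PG N F)
    exact ⟨_, Finset.univ, fun P hP => absurd (Finset.mem_coe.2 (Finset.mem_univ P)) hP, rfl⟩
  exact Nat.sInf_mem hne

/-- `R` is the covering radius of the linear code `C` of length `n`: the least integer `R` such that
every vector is at Hamming distance at most `R` from some codeword. -/
def IsCoveringRadius {n : ℕ} {F : Type*} [Field F] [DecidableEq F]
    (C : Submodule F (Fin n → F)) (R : ℕ) : Prop :=
  IsLeast {ρ : ℕ | ∀ x : Fin n → F, ∃ c ∈ C, hammingDist x c ≤ ρ} R

/-- The length function `ℓ(R, r, q)`: the smallest length `n` of a linear code over the field `F`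
(with `q = |F|`) that has covering radius `R` and codimension `r`. -/
noncomputable def lengthFunction (R r : ℕ) (F : Type*) [Field F] [DecidableEq F] : ℕ :=
  sInf {n : ℕ | ∃ C : Submodule F (Fin n → F),
    Module.finrank F C + r = n ∧ IsCoveringRadius C R}

/-- `Υ(q) = √((q+1)(3 ln q + ln ln q + ln (3/4))) + √(q / (3 ln q)) + 3`. -/
noncomputable def Upsilon (q : ℝ) : ℝ :=
  Real.sqrt ((q + 1) * (3 * Real.log q + Real.log (Real.log q) + Real.log (3 / 4)))
    + Real.sqrt (q / (3 * Real.log q)) + 3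

/-! The vectors representing a saturating set are the columns of a parity-check matrix. Saturation
says that every syndrome combines at most two columns, that is, covering radius at most 2. A
smallest saturating set cannot have radius below 2, since it would be the whole space, which still
saturates after losing a point. Hence s = ℓ.

For the bound, write N = 2m + 2 and lift from the plane. If S covers F³ and |S| ≤ q, give its
members distinct labels β in F. The vectors (x, ξ, βξ), with x in S and ξ in F^m, together with the
points of the two coordinate copies of F^m, cover F³ × F^m × F^m. Their number is at most |S| q^m +
2(q^m - 1)/(q - 1).

In the plane, greedy choice with an averaging argument takes about √((q+1)L) points, where L = 3 ln
q + ln ln q + ln(3/4), and leaves about 2√(q/(3 ln q)) points uncovered. These are then covered two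
at a time. The total is at most Υ(q) - 1/2, and the spare q^m/2 pays for the coordinate points of
the lift. So Υ(q) q^m suffices for every even N ≥ 4, and the lower-order terms of the statement are
slack. -/

/-- `v` is a linear combination of two members of `S`. -/
def IsCoveredBy (F : Type*) {V : Type*} [Field F] [AddCommGroup V] [Module F V]
    (S : Finset V) (v : V) : Prop :=
  ∃ x ∈ S, ∃ y ∈ S, ∃ a b : F, a • x + b • y = v

/-! ### Two-term combinations and collinearity -/

section Covering

variable {F V W : Type*} [Field F] [AddCommGroup V] [Module F V] [AddCommGroup W] [Module F W]

theorem IsCoveredBy.mono {S T : Finset V} (h : S ⊆ T) {v : V} (hv : IsCoveredBy F S v) :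
    IsCoveredBy F T v := by
  obtain ⟨x, hx, y, hy, a, b, rfl⟩ := hv
  exact ⟨x, h hx, y, h hy, a, b, rfl⟩

theorem IsCoveredBy.smul {S : Finset V} {v : V} (c : F) (hv : IsCoveredBy F S v) :
    IsCoveredBy F S (c • v) := by
  obtain ⟨x, hx, y, hy, a, b, rfl⟩ := hv
  exact ⟨x, hx, y, hy, c * a, c * b, by rw [smul_add, smul_smul, smul_smul]⟩

theorem isCoveredBy_smul_iff {S : Finset V} {v : V} {c : F} (hc : c ≠ 0) :
    IsCoveredBy F S (c • v) ↔ IsCoveredBy F S v := by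
  refine ⟨fun h => ?_, fun h => h.smul c⟩
  simpa [smul_smul, inv_mul_cancel₀ hc] using h.smul c⁻¹

theorem isCoveredBy_smul_of_mem {S : Finset V} {x : V} (hx : x ∈ S) (a : F) :
    IsCoveredBy F S (a • x) :=
  ⟨x, hx, x, hx, a, 0, by simp⟩

theorem IsCoveredBy.image [DecidableEq W] {S : Finset V} {v : V} (hv : IsCoveredBy F S v)
    (f : V →ₗ[F] W) : IsCoveredBy F (S.image f) (f v) := by
  obtain ⟨x, hx, y, hy, a, b, rfl⟩ := hv
  exact ⟨f x, Finset.mem_image_of_mem _ hx, f y, Finset.mem_image_of_mem _ hy, a, b, by simp⟩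

theorem isCollinear_triple_iff {v x y : V} (hv : v ≠ 0) (hx : x ≠ 0) (hy : y ≠ 0)
    (hxy : Projectivization.mk F x hx ≠ Projectivization.mk F y hy) :
    Projectivization.IsCollinear
      {Projectivization.mk F v hv, Projectivization.mk F x hx, Projectivization.mk F y hy} ↔
      ∃ a b : F, a • x + b • y = v := by
  rw [← Submodule.mem_span_pair]
  have hind : LinearIndependent F ![x, y] := by
    rw [LinearIndependent.pair_iff' hx]
    intro a ha
    exact hxy ((Projectivization.mk_eq_mk_iff' F y x hy hx).2 ⟨a, ha⟩).symm
  have hrank : Module.finrank F (Submodule.span F ({x, y} : Set V)) = 2 := by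
    rw [← Matrix.range_cons_cons_empty x y ![]]
    simp [finrank_span_eq_card hind]
  constructor
  · rintro ⟨M, hfin, hM, hsub⟩
    have hmem : ∀ {z : V} (hz : z ≠ 0), Projectivization.mk F z hz ∈ M → z ∈ M.submodule :=
      fun hz h => (Projectivization.Subspace.mem_submodule_iff M hz).2 h
    have hle : Submodule.span F ({x, y} : Set V) ≤ M.submodule := by
      rw [Submodule.span_le]
      rintro z (rfl | rfl)
      · exact hmem hx (hsub (by simp))
      · exact hmem hy (hsub (by simp))
    have heq := Submodule.eq_of_le_of_finrank_le hle (by omega)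
    rw [heq]
    exact hmem hv (hsub (by simp))
  · intro h
    refine ⟨(Submodule.span F {x, y}).projectivization, ?_, ?_, ?_⟩
    · rw [Projectivization.Subspace.submodule.apply_symm_apply]
      exact Module.Finite.span_of_finite _ (Set.toFinite _)
    · rw [Projectivization.Subspace.submodule.apply_symm_apply, hrank]
    · rintro z (rfl | rfl | rfl)
      · exact h
      · exact Submodule.subset_span (by simp)
      · exact Submodule.subset_span (by simp)

end Covering

/-! ### Saturating sets and codes of covering radius 2 -/

section Saturating

variable {F : Type*} [Field F] {N : ℕ}

theorem saturatingNumber_le_card {S : Finset (PG N F)} (hS : IsSaturating (S : Set (PG N F))) :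
    saturatingNumber N F ≤ S.card :=
  Nat.sInf_le ⟨S, hS, rfl⟩

/-- Zero vectors are dropped and proportional ones merge. A point outside the resulting set is a
multiple of no member of `S`, so a combination giving it must use two distinct points. -/
theorem saturatingNumber_le_card_of_isCoveredBy {S : Finset (Fin (N + 1) → F)}
    (hS : ∀ v, IsCoveredBy F S v) : saturatingNumber N F ≤ S.card := by
  classical
  have h0 : ∀ x : {x // x ∈ S.filter (· ≠ 0)}, x.1 ≠ 0 := fun x => (Finset.mem_filter.1 x.2).2
  let T : Finset (PG N F) :=
    (S.filter (· ≠ 0)).attach.image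
      fun x => Projectivization.mk F x.1 (h0 x)
  have hmem : ∀ {x : Fin (N + 1) → F} (_ : x ∈ S) (h0 : x ≠ 0), Projectivization.mk F x h0 ∈ T :=
    fun {x} hx h0 =>
      Finset.mem_image.2 ⟨⟨x, Finset.mem_filter.2 ⟨hx, h0⟩⟩, Finset.mem_attach _ _, rfl⟩
  have hT : IsSaturating (T : Set (PG N F)) := by
    intro P hP
    induction P using Projectivization.ind with | h v hv =>
    have hne : ∀ x ∈ S, ∀ a : F, a • x ≠ v := by
      rintro x hx a rfl
      have h0 : x ≠ 0 := by rintro rfl; simp at hv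
      refine hP ?_
      rw [(Projectivization.mk_eq_mk_iff' F _ x hv h0).2 ⟨a, rfl⟩]
      exact hmem hx h0
    obtain ⟨x, hx, y, hy, a, b, hab⟩ := hS v
    have hx0 : x ≠ 0 := by
      rintro rfl
      exact hne y hy b (by simpa using hab)
    have hy0 : y ≠ 0 := by
      rintro rfl
      exact hne x hx a (by simpa using hab)
    have hxy : Projectivization.mk F x hx0 ≠ Projectivization.mk F y hy0 := by
      intro h
      obtain ⟨c, rfl⟩ := (Projectivization.mk_eq_mk_iff' F x y hx0 hy0).1 h
      exact hne y hy (a * c + b) (by rw [← hab, smul_smul, add_smul])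
    exact ⟨_, hmem hx hx0, _, hmem hy hy0, hxy, (isCollinear_triple_iff hv hx0 hy0 hxy).2 ⟨a, b, hab⟩⟩
  calc saturatingNumber N F ≤ T.card := saturatingNumber_le_card hT
    _ ≤ (S.filter (· ≠ 0)).attach.card := Finset.card_image_le
    _ ≤ S.card := by rw [Finset.card_attach]; exact Finset.card_filter_le _ _

theorem IsSaturating.nonempty {S : Finset (PG N F)} (hS : IsSaturating (S : Set (PG N F))) :
    S.Nonempty := by
  obtain ⟨P⟩ : Nonempty (PG N F) := inferInstance
  by_cases hP : P ∈ S
  · exact ⟨P, hP⟩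
  · obtain ⟨A, hA, -⟩ := hS P (by simpa using hP)
    exact ⟨A, by simpa using hA⟩

theorem IsSaturating.isCoveredBy [DecidableEq F] {S : Finset (PG N F)}
    (hS : IsSaturating (S : Set (PG N F))) (v : Fin (N + 1) → F) :
    IsCoveredBy F (S.image Projectivization.rep) v := by
  by_cases hv : v = 0
  · obtain ⟨P, hP⟩ := hS.nonempty
    simpa [hv] using isCoveredBy_smul_of_mem (Finset.mem_image_of_mem Projectivization.rep hP) (0 : F)
  by_cases hP : Projectivization.mk F v hv ∈ S
  · obtain ⟨a, ha⟩ := Projectivization.exists_smul_eq_mk_rep F v hv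
    have := isCoveredBy_smul_of_mem (Finset.mem_image_of_mem Projectivization.rep hP) (a⁻¹ : Fˣ).1
    rw [← ha, ← Units.smul_def, inv_smul_smul] at this
    exact this
  · obtain ⟨A, hA, B, hB, hAB, hcol⟩ := hS _ (by simpa using hP)
    rw [← A.mk_rep, ← B.mk_rep] at hcol hAB
    obtain ⟨a, b, hab⟩ := (isCollinear_triple_iff hv _ _ hAB).1 hcol
    exact ⟨_, Finset.mem_image_of_mem _ hA, _, Finset.mem_image_of_mem _ hB, a, b, hab⟩

/-- In positive dimension every point lies on a line through two further points. -/
theorem isSaturating_compl_singleton (hN : 1 ≤ N) (P : PG N F) :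
    IsSaturating ({P}ᶜ : Set (PG N F)) := by
  intro Q hQ
  obtain rfl : Q = P := by simpa using hQ
  induction Q using Projectivization.ind with | h v hv =>
  obtain ⟨w, hw⟩ : ∃ w, w ∉ Submodule.span F {v} := by
    by_contra! h
    have h1 : Submodule.span F {v} = ⊤ := by ext; simp [h]
    have h2 := finrank_span_singleton (K := F) hv
    rw [h1, finrank_top, Module.finrank_fin_fun] at h2
    omega
  rw [Submodule.mem_span_singleton] at hw
  push Not at hw
  have hw0 : w ≠ 0 := fun h => hw 0 (by simp [h])
  have hvw : v + w ≠ 0 := fun h => hw (-1) (by rw [neg_one_smul]; exact neg_eq_of_add_eq_zero_right h)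
  have h1 : Projectivization.mk F w hw0 ≠ Projectivization.mk F (v + w) hvw := by
    intro h
    obtain ⟨c, hc⟩ := (Projectivization.mk_eq_mk_iff' F _ _ hvw hw0).1 h.symm
    by_cases hc1 : c = 1
    · exact hv (by simpa [hc1] using hc)
    · have h3 : (c - 1) • w = v := by rw [sub_smul, one_smul, hc, add_sub_cancel_right]
      exact hw (c - 1)⁻¹ (by rw [← h3, smul_smul, inv_mul_cancel₀ (sub_ne_zero.2 hc1), one_smul])
  refine ⟨_, ?_, _, ?_, h1, (isCollinear_triple_iff hv hw0 hvw h1).2 ⟨-1, 1, by simp⟩⟩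
  · intro h
    obtain ⟨c, hc⟩ := (Projectivization.mk_eq_mk_iff' F _ _ hw0 hv).1 h
    exact hw c hc
  · intro h
    obtain ⟨c, hc⟩ := (Projectivization.mk_eq_mk_iff' F _ _ hvw hv).1 h
    exact hw (c - 1) (by rw [sub_smul, one_smul, hc, add_sub_cancel_left])

theorem isCoveredBy_apply_of_hammingNorm_le_two {n : ℕ} [DecidableEq F] {V : Type*}
    [AddCommGroup V] [Module F V] [DecidableEq V] (hn : 0 < n) (f : (Fin n → F) →ₗ[F] V)
    {x : Fin n → F} (hx : hammingNorm x ≤ 2) :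
    IsCoveredBy F (Finset.univ.image fun i => f (Pi.single i 1)) (f x) := by
  have hsum : f x = ∑ i with x i ≠ 0, x i • f (Pi.single i 1) := by
    rw [LinearMap.pi_apply_eq_sum_univ f x, Finset.sum_filter_of_ne]
    · refine Finset.sum_congr rfl fun i _ => ?_
      congr 2
      ext j
      simp [Pi.single_apply, eq_comm]
    · intro i _ h h0
      simp [h0] at h
  have hmem : ∀ i, f (Pi.single i 1) ∈ Finset.univ.image fun i => f (Pi.single i 1) :=
    fun i => Finset.mem_image_of_mem _ (Finset.mem_univ i)
  rw [hsum]
  unfold hammingNorm at hx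
  interval_cases h : (Finset.univ.filter fun i => x i ≠ 0).card
  · rw [Finset.card_eq_zero.1 h]
    simpa using isCoveredBy_smul_of_mem (hmem ⟨0, hn⟩) (0 : F)
  · obtain ⟨i, hi⟩ := Finset.card_eq_one.1 h
    rw [hi, Finset.sum_singleton]
    exact isCoveredBy_smul_of_mem (hmem i) _
  · obtain ⟨i, j, hij, hs⟩ := Finset.card_eq_two.1 h
    rw [hs, Finset.sum_pair hij]
    exact ⟨_, hmem i, _, hmem j, _, _, rfl⟩

/-- The quotient by `C`, identified with the ambient space of PG(N, q), gives a parity-check map.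
Subtracting a nearby codeword leaves a vector of weight at most 2 with the same syndrome. -/
theorem saturatingNumber_le_of_isCoveringRadius [DecidableEq F] {n : ℕ}
    {C : Submodule F (Fin n → F)} (hC : Module.finrank F C + (N + 1) = n)
    (hR : IsCoveringRadius C 2) : saturatingNumber N F ≤ n := by
  have hfin : Module.finrank F ((Fin n → F) ⧸ C) = Module.finrank F (Fin (N + 1) → F) := by
    have := C.finrank_quotient_add_finrank
    rw [Module.finrank_fin_fun] at this ⊢
    omega
  let f : (Fin n → F) →ₗ[F] (Fin (N + 1) → F) :=
    (LinearEquiv.ofFinrankEq _ _ hfin).toLinearMap ∘ₗ C.mkQ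
  have hf : Function.Surjective f :=
    (LinearEquiv.ofFinrankEq _ _ hfin).surjective.comp C.mkQ_surjective
  have hker : ∀ c ∈ C, f c = 0 := by
    intro c hc
    simp [f, (Submodule.Quotient.mk_eq_zero C).2 hc]
  have hcov : ∀ v, IsCoveredBy F (Finset.univ.image fun i => f (Pi.single i 1)) v := by
    intro v
    obtain ⟨x, rfl⟩ := hf v
    obtain ⟨c, hc, hxc⟩ := hR.1 x
    rw [hammingDist_comm, hammingDist_eq_hammingNorm, neg_add_eq_sub] at hxc
    have := isCoveredBy_apply_of_hammingNorm_le_two (by omega) f hxc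
    rwa [map_sub, hker c hc, sub_zero] at this
  calc saturatingNumber N F ≤ _ := saturatingNumber_le_card_of_isCoveredBy hcov
    _ ≤ (Finset.univ : Finset (Fin n)).card := Finset.card_image_le
    _ = n := by simp

theorem exists_isCoveringRadius_two [Finite F] [DecidableEq F] (hN : 1 ≤ N) :
    ∃ C : Submodule F (Fin (saturatingNumber N F) → F),
      Module.finrank F C + (N + 1) = saturatingNumber N F ∧ IsCoveringRadius C 2 := by
  classical
  obtain ⟨S, hS, hcard⟩ := saturatingNumber_attained N F
  generalize hs : saturatingNumber N F = n at hcard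
  let e : Fin n ≃ S := (Fintype.equivFinOfCardEq (by simp [hcard])).symm
  let h : Fin n → Fin (N + 1) → F := fun i => (e i).1.rep
  have hh : ∀ v ∈ S.image Projectivization.rep, ∃ i, h i = v := by
    intro v hv
    obtain ⟨P, hP, rfl⟩ := Finset.mem_image.1 hv
    exact ⟨e.symm ⟨P, hP⟩, by simp [h]⟩
  let f : (Fin n → F) →ₗ[F] (Fin (N + 1) → F) := Fintype.linearCombination F h
  have hsingle : ∀ i a, f (Pi.single i a) = a • h i := fun i a => by
    simp [f, Fintype.linearCombination_apply_single]
  have hf : ∀ v, ∃ x, hammingNorm x ≤ 2 ∧ f x = v := by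
    intro v
    obtain ⟨x, hx, y, hy, a, b, rfl⟩ := hS.isCoveredBy v
    obtain ⟨i, rfl⟩ := hh x hx
    obtain ⟨j, rfl⟩ := hh y hy
    refine ⟨Pi.single i a + Pi.single j b, ?_, by rw [map_add, hsingle, hsingle]⟩
    calc hammingNorm (Pi.single i a + Pi.single j b : Fin n → F)
        ≤ ({i, j} : Finset (Fin n)).card := by
          refine Finset.card_le_card fun k hk => ?_
          by_contra hk'
          simp only [Finset.mem_insert, Finset.mem_singleton, not_or] at hk'
          simp [Pi.single_apply, hk'.1, hk'.2] at hk
      _ ≤ 2 := Finset.card_le_two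
  refine ⟨LinearMap.ker f, ?_, ?_, ?_⟩
  · have hsurj : LinearMap.range f = ⊤ :=
      LinearMap.range_eq_top.2 fun v => (hf v).imp fun x hx => hx.2
    have := f.finrank_range_add_finrank_ker
    rw [hsurj, finrank_top, Module.finrank_fin_fun, Module.finrank_fin_fun] at this
    omega
  · intro x
    obtain ⟨y, hy, hxy⟩ := hf (f x)
    refine ⟨x - y, by simp [LinearMap.mem_ker, hxy], ?_⟩
    rwa [hammingDist_comm, hammingDist_eq_hammingNorm, neg_add_eq_sub, sub_sub_cancel]
  -- With radius at most 1 every nonzero syndrome is a multiple of one column, so `S` is the whole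
  -- space. Deleting a point then contradicts minimality.
  · intro ρ hρ
    by_contra! hlt
    have hall : ∀ P : PG N F, P ∈ S := by
      intro P
      induction P using Projectivization.ind with | h v hv =>
      obtain ⟨x, -, rfl⟩ := hf v
      obtain ⟨c, hc, hxc⟩ := hρ x
      rw [hammingDist_comm, hammingDist_eq_hammingNorm, neg_add_eq_sub] at hxc
      have hfx : f (x - c) = f x := by rw [map_sub, LinearMap.mem_ker.1 hc, sub_zero]
      have hne : x - c ≠ 0 := fun h0 => hv (by rw [← hfx, h0, map_zero])
      have h1 : hammingNorm (x - c) = 1 := by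
        have := hammingNorm_pos_iff.2 hne
        omega
      obtain ⟨i, hi⟩ := Finset.card_eq_one.1 h1
      have hxi : x - c = Pi.single i ((x - c) i) := by
        ext k
        by_cases hk : k = i
        · subst hk; simp
        · have : k ∉ (Finset.univ.filter fun k => (x - c) k ≠ 0) := by rw [hi]; simpa using hk
          rw [Pi.single_eq_of_ne hk]
          simpa using this
      rw [hxi, hsingle] at hfx
      have : Projectivization.mk F (f x) hv = (e i).1 := by
        rw [← (e i).1.mk_rep]
        exact (Projectivization.mk_eq_mk_iff' F _ _ _ _).2 ⟨_, hfx⟩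
      rw [this]
      exact (e i).2
    obtain ⟨P, hP⟩ := hS.nonempty
    have hsat : IsSaturating ((S.erase P : Finset (PG N F)) : Set (PG N F)) := by
      have : ((S.erase P : Finset (PG N F)) : Set (PG N F)) = {P}ᶜ := by
        ext Q; simp [hall Q]
      rw [this]
      exact isSaturating_compl_singleton hN P
    have h1 := saturatingNumber_le_card hsat
    have h2 := Finset.card_erase_lt_of_mem hP
    omega

theorem saturatingNumber_eq_lengthFunction [Finite F] [DecidableEq F] (hN : 1 ≤ N) :
    saturatingNumber N F = lengthFunction 2 (N + 1) F := by
  have hmem := exists_isCoveringRadius_two (F := F) hN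
  refine le_antisymm ?_ (Nat.sInf_le hmem)
  obtain ⟨C, hC, hR⟩ := Nat.sInf_mem (s := {n : ℕ | ∃ C : Submodule F (Fin n → F),
    Module.finrank F C + (N + 1) = n ∧ IsCoveringRadius C 2}) ⟨_, hmem⟩
  exact saturatingNumber_le_of_isCoveringRadius hC hR

end Saturating

/-! ### Lifting from the plane to higher dimension -/

section Lifting

variable {F V W : Type*} [Field F] [AddCommGroup V] [Module F V] [AddCommGroup W] [Module F W]

/-- A linear system of determinant ab(γ - β); this is why the labels in the lift must be distinct.
-/
theorem exists_smul_add_smul_eq {a b β γ : F} (ha : a ≠ 0) (hb : b ≠ 0) (hβγ : β ≠ γ)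
    (u v : W) : ∃ ξ η : W, a • ξ + b • η = u ∧ a • β • ξ + b • γ • η = v := by
  have hd : β - γ ≠ 0 := sub_ne_zero.2 hβγ
  refine ⟨(a⁻¹ * (β - γ)⁻¹) • (v - γ • u), (b⁻¹ * (β - γ)⁻¹) • (β • u - v), ?_, ?_⟩
  · match_scalars <;> field_simp <;> ring
  · match_scalars <;> field_simp <;> ring

variable [Finite F]

/-- A covering set of `V` of size at most `|F|` lifts to a covering set of `V × W × W`. -/
theorem exists_isCoveredBy_prod [Finite W] [DecidableEq V] {S : Finset V}
    (hS : ∀ v, IsCoveredBy F S v) (hcard : S.card ≤ Nat.card F) :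
    ∃ T : Finset (V × W × W), (∀ v, IsCoveredBy F T v) ∧
      T.card ≤ S.card * Nat.card W + 2 * Nat.card (ℙ F W) := by
  classical
  have := Fintype.ofFinite F
  have := Fintype.ofFinite W
  have := Fintype.ofFinite (ℙ F W)
  -- The labels, available because `S` has at most as many members as `F`.
  obtain ⟨β⟩ : Nonempty (S ↪ F) :=
    Function.Embedding.nonempty_of_card_le (by simpa [Nat.card_eq_fintype_card] using hcard)
  let A : Finset (V × W × W) :=
    (Finset.univ : Finset (S × W)).image fun p => (p.1.1, p.2, β p.1 • p.2)
  let B : Finset (V × W × W) := (Finset.univ : Finset (ℙ F W)).image fun P => (0, P.rep, 0)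
  let C : Finset (V × W × W) := (Finset.univ : Finset (ℙ F W)).image fun P => (0, 0, P.rep)
  have hA : ∀ (x : S) (ξ : W), (x.1, ξ, β x • ξ) ∈ A ∪ (B ∪ C) := fun x ξ =>
    Finset.mem_union_left _ (Finset.mem_image.2 ⟨(x, ξ), Finset.mem_univ _, rfl⟩)
  have hB : ∀ P : ℙ F W, ((0, P.rep, 0) : V × W × W) ∈ A ∪ (B ∪ C) := fun P =>
    Finset.mem_union_right _ (Finset.mem_union_left _ (Finset.mem_image_of_mem _ (Finset.mem_univ P)))
  have hC : ∀ P : ℙ F W, ((0, 0, P.rep) : V × W × W) ∈ A ∪ (B ∪ C) := fun P =>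
    Finset.mem_union_right _ (Finset.mem_union_right _ (Finset.mem_image_of_mem _ (Finset.mem_univ P)))
  have hrep : ∀ w : W, w ≠ 0 → ∃ (P : ℙ F W) (c : F), c • P.rep = w := by
    intro w hw
    obtain ⟨a, ha⟩ := Projectivization.exists_smul_eq_mk_rep F w hw
    exact ⟨_, (a⁻¹ : Fˣ).1, by rw [← ha, ← Units.smul_def, inv_smul_smul]⟩
  -- The case where the first coordinate needs only one member of `S`. For a ≠ 0, the vector over x
  -- with ξ = a⁻¹u, scaled by a, matches everything but the defect v - βu, which a point of `C`
  -- supplies. For a = 0, `B` and `C` suffice.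
  have hone : ∀ (x : S) (a : F) (u v : W), IsCoveredBy F (A ∪ (B ∪ C)) (a • x.1, u, v) := by
    intro x a u v
    by_cases ha : a = 0
    · subst ha
      by_cases hu : u = 0
      · by_cases hv : v = 0
        · simpa [hu, hv, ← Prod.zero_eq_mk] using isCoveredBy_smul_of_mem (hA x 0) (0 : F)
        · obtain ⟨P, c, rfl⟩ := hrep v hv
          simpa [hu] using isCoveredBy_smul_of_mem (hC P) c
      · obtain ⟨P, c, rfl⟩ := hrep u hu
        by_cases hv : v = 0
        · simpa [hv] using isCoveredBy_smul_of_mem (hB P) c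
        · obtain ⟨Q, d, rfl⟩ := hrep v hv
          exact ⟨_, hB P, _, hC Q, c, d, by simp⟩
    · by_cases hw : v - β x • u = 0
      · rw [sub_eq_zero] at hw
        refine ⟨_, hA x (a⁻¹ • u), _, hA x (a⁻¹ • u), a, 0, ?_⟩
        simp [hw, smul_smul, ha, mul_left_comm a]
      · obtain ⟨P, c, hc⟩ := hrep _ hw
        refine ⟨_, hA x (a⁻¹ • u), _, hC P, a, c, ?_⟩
        simp [hc, smul_smul, ha, mul_left_comm a]
  refine ⟨A ∪ (B ∪ C), ?_, ?_⟩
  · rintro ⟨s, u, v⟩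
    obtain ⟨x, hx, y, hy, a, b, rfl⟩ := hS s
    by_cases ha : a = 0
    · simpa [ha] using hone ⟨y, hy⟩ b u v
    by_cases hb : b = 0
    · simpa [hb] using hone ⟨x, hx⟩ a u v
    by_cases hxy : x = y
    · subst hxy
      simpa [add_smul] using hone ⟨x, hx⟩ (a + b) u v
    have hβ : β ⟨x, hx⟩ ≠ β ⟨y, hy⟩ := fun h => hxy (congrArg Subtype.val (β.injective h))
    obtain ⟨ξ, η, rfl, rfl⟩ := exists_smul_add_smul_eq ha hb hβ u v
    exact ⟨_, hA ⟨x, hx⟩ ξ, _, hA ⟨y, hy⟩ η, a, b, rfl⟩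
  · have h1 : A.card ≤ S.card * Nat.card W := by
      refine Finset.card_image_le.trans ?_
      simp [Nat.card_eq_fintype_card]
    have h2 : B.card ≤ Nat.card (ℙ F W) := by
      refine Finset.card_image_le.trans ?_
      simp [Nat.card_eq_fintype_card]
    have h3 : C.card ≤ Nat.card (ℙ F W) := by
      refine Finset.card_image_le.trans ?_
      simp [Nat.card_eq_fintype_card]
    have h4 := Finset.card_union_le A (B ∪ C)
    have h5 := Finset.card_union_le B C
    omega

theorem saturatingNumber_le_of_plane {S : Finset (Fin 3 → F)} (hS : ∀ v, IsCoveredBy F S v)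
    (hcard : S.card ≤ Nat.card F) {N m : ℕ} (hN : N = 2 * m + 2) :
    saturatingNumber N F ≤ S.card * Nat.card F ^ m + 2 * Nat.card (ℙ F (Fin m → F)) := by
  classical
  obtain ⟨T, hT, hTcard⟩ := exists_isCoveredBy_prod (W := Fin m → F) hS hcard
  have hrank : Module.finrank F ((Fin 3 → F) × (Fin m → F) × (Fin m → F)) =
      Module.finrank F (Fin (N + 1) → F) := by
    simp only [Module.finrank_prod, Module.finrank_fin_fun]
    omega
  let e := LinearEquiv.ofFinrankEq _ _ hrank
  have hcov : ∀ v, IsCoveredBy F (T.image e.toLinearMap) v := by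
    intro v
    simpa using (hT (e.symm v)).image e.toLinearMap
  refine (saturatingNumber_le_card_of_isCoveredBy hcov).trans (Finset.card_image_le.trans ?_)
  simpa [Nat.card_fun] using hTcard

end Lifting

/-! ### Greedy construction -/

section Greedy

variable {F V : Type*} [Field F] [AddCommGroup V] [Module F V]

/-- The members of `S` represent distinct points of the projective space. -/
structure IsPointSet (F : Type*) {V : Type*} [Field F] [AddCommGroup V] [Module F V]
    (S : Finset V) : Prop where
  zero_notMem : (0 : V) ∉ S
  eq_of_smul_eq : ∀ x ∈ S, ∀ y ∈ S, ∀ c : F, c • x = y → x = y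

theorem IsPointSet.insert [DecidableEq V] {S : Finset V} (hS : IsPointSet F S) {P : V}
    (hP0 : P ≠ 0) (hP : ∀ x ∈ S, ∀ c : F, c • x ≠ P) : IsPointSet F (insert P S) where
  zero_notMem := by
    rw [Finset.mem_insert]
    rintro (h | h)
    · exact hP0 h.symm
    · exact hS.zero_notMem h
  eq_of_smul_eq := by
    intro x hx y hy c hc
    rw [Finset.mem_insert] at hx hy
    rcases hx with rfl | hx <;> rcases hy with rfl | hy
    · rfl
    · have hc0 : c ≠ 0 := by
        rintro rfl
        rw [zero_smul] at hc
        exact hS.zero_notMem (hc ▸ hy)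
      exact absurd (by rw [← hc, smul_smul, inv_mul_cancel₀ hc0, one_smul]) (hP y hy c⁻¹)
    · exact absurd hc (hP x hx c)
    · exact hS.eq_of_smul_eq x hx y hy c hc

theorem IsPointSet.eq_zero_of_smul_add_smul_eq_zero {S : Finset V} (hS : IsPointSet F S)
    {x y : V} (hx : x ∈ S) (hy : y ∈ S) (hxy : x ≠ y) {a b : F} (h : a • x + b • y = 0) :
    a = 0 ∧ b = 0 := by
  have hx0 : x ≠ 0 := fun h => hS.zero_notMem (h ▸ hx)
  have hb : b = 0 := by
    by_contra hb
    refine hxy (hS.eq_of_smul_eq x hx y hy (-(b⁻¹ * a)) ?_)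
    rw [neg_smul, mul_smul, eq_neg_of_add_eq_zero_left h, smul_neg, smul_smul,
      inv_mul_cancel₀ hb, one_smul, neg_neg]
  refine ⟨?_, hb⟩
  simpa [hb, hx0] using h

variable [Fintype V]

open Classical in
/-- The vectors that are not a linear combination of two members of `S`. -/
noncomputable def uncovered (F : Type*) {V : Type*} [Field F] [AddCommGroup V] [Module F V]
    [Fintype V] (S : Finset V) : Finset V :=
  Finset.univ.filter fun v => ¬ IsCoveredBy F S v

theorem mem_uncovered {S : Finset V} {v : V} : v ∈ uncovered F S ↔ ¬ IsCoveredBy F S v := by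
  simp [uncovered]

variable [DecidableEq V] [Fintype F]

/-- Each P = aQ + bs with a, b nonzero and s in `S` puts Q in the span of P and s. Different triples
give different P, because Q is uncovered and the members of `S` are distinct points. -/
theorem sq_mul_card_le_card_isCoveredBy_insert {S : Finset V} (hS : IsPointSet F S) {Q : V}
    (hQ : Q ∈ uncovered F S) [DecidablePred fun P => IsCoveredBy F (insert P S) Q] :
    (Fintype.card F - 1) ^ 2 * S.card ≤
      (Finset.univ.filter fun P => IsCoveredBy F (insert P S) Q).card := by
  classical
  rw [mem_uncovered] at hQ
  have hinj : Function.Injective fun p : Fˣ × Fˣ × S => p.1 • Q + p.2.1 • p.2.2.1 := by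
    rintro ⟨a, b, s⟩ ⟨a', b', s'⟩ h
    simp only [Units.smul_def] at h
    have ha : (a : F) = a' := by
      by_contra hne
      have hd : (a : F) - a' ≠ 0 := sub_ne_zero.2 hne
      refine hQ ((isCoveredBy_smul_iff hd).1 ⟨s'.1, s'.2, s.1, s.2, b', -b, ?_⟩)
      rw [sub_smul, neg_smul, ← sub_eq_add_neg, sub_eq_sub_iff_add_eq_add,
        add_comm _ ((a' : F) • Q), ← h]
    have hb : (b : F) • s.1 = (b' : F) • s'.1 := by
      rw [ha] at h
      exact add_left_cancel h
    have hs : s.1 = s'.1 := by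
      refine hS.eq_of_smul_eq _ s.2 _ s'.2 ((b' : F)⁻¹ * b) ?_
      rw [mul_smul, hb, smul_smul, inv_mul_cancel₀ b'.ne_zero, one_smul]
    have hs0 : s'.1 ≠ 0 := fun h => hS.zero_notMem (h ▸ s'.2)
    rw [hs] at hb
    have hb' : (b : F) = b' := smul_left_injective F hs0 hb
    simp only [Prod.mk.injEq]
    exact ⟨Units.ext ha, Units.ext hb', Subtype.ext hs⟩
  calc (Fintype.card F - 1) ^ 2 * S.card = Fintype.card (Fˣ × Fˣ × S) := by
        simp [Fintype.card_prod, Fintype.card_units, sq, mul_assoc]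
    _ = (Finset.univ.image fun p : Fˣ × Fˣ × S => p.1 • Q + p.2.1 • p.2.2.1).card := by
        rw [Finset.card_image_of_injective _ hinj, Finset.card_univ]
    _ ≤ _ := by
        refine Finset.card_le_card fun P hP => ?_
        obtain ⟨⟨a, b, s⟩, -, rfl⟩ := Finset.mem_image.1 hP
        refine Finset.mem_filter.2 ⟨Finset.mem_univ _, ?_⟩
        refine (isCoveredBy_smul_iff a.ne_zero).1
          ⟨_, Finset.mem_insert_self _ _, s.1, Finset.mem_insert_of_mem s.2, 1, -b, ?_⟩
        simp [Units.smul_def]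

/-- Double counting of pairs (P, Q) in which adding P covers the uncovered Q; the best P does at
least as well as the average. -/
theorem exists_card_uncovered_insert_le {S : Finset V} (hS : IsPointSet F S) :
    ∃ P, (uncovered F S).card * ((Fintype.card F - 1) ^ 2 * S.card) +
      Fintype.card V * (uncovered F (insert P S)).card ≤
        Fintype.card V * (uncovered F S).card := by
  classical
  have hdc : ∑ P : V, ((uncovered F S).filter fun Q => IsCoveredBy F (insert P S) Q).card =
      ∑ Q ∈ uncovered F S, (Finset.univ.filter fun P => IsCoveredBy F (insert P S) Q).card :=
    Finset.sum_card_bipartiteAbove_eq_sum_card_bipartiteBelow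
      (fun P Q => IsCoveredBy F (insert P S) Q)
  have hle : (uncovered F S).card * ((Fintype.card F - 1) ^ 2 * S.card) ≤
      ∑ P : V, ((uncovered F S).filter fun Q => IsCoveredBy F (insert P S) Q).card := by
    rw [hdc, ← smul_eq_mul]
    exact Finset.card_nsmul_le_sum _ _ _ fun Q hQ => sq_mul_card_le_card_isCoveredBy_insert hS hQ
  obtain ⟨P, -, hP⟩ := Finset.exists_max_image (Finset.univ : Finset V)
    (fun P => ((uncovered F S).filter fun Q => IsCoveredBy F (insert P S) Q).card)
    Finset.univ_nonempty
  refine ⟨P, ?_⟩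
  have hsum := Finset.sum_le_card_nsmul _ _ _ hP
  rw [Finset.card_univ, smul_eq_mul] at hsum
  have hsplit := Finset.card_filter_add_card_filter_not
    (s := uncovered F S) (fun Q => IsCoveredBy F (insert P S) Q)
  have heq : (uncovered F S).filter (fun Q => ¬ IsCoveredBy F (insert P S) Q) =
      uncovered F (insert P S) := by
    ext Q
    simp only [Finset.mem_filter, mem_uncovered, and_iff_right_iff_imp]
    exact fun h h' => h (h'.mono (Finset.subset_insert _ _))
  rw [heq] at hsplit
  rw [← hsplit, mul_add (Fintype.card V), hsplit]
  exact Nat.add_le_add_right (hle.trans hsum) _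

/-- Adding points greedily, each new point covers at least the average proportion of the vectors
that are still uncovered. -/
theorem exists_card_uncovered_le_mul_exp [Nontrivial V] (k : ℕ) :
    ∃ S : Finset V, IsPointSet F S ∧ S.card ≤ k + 1 ∧ (uncovered F S = ∅ ∨ S.card = k + 1) ∧
      ((uncovered F S).card : ℝ) ≤ Fintype.card V *
        Real.exp (-(((Fintype.card F : ℝ) - 1) ^ 2 / Fintype.card V * ((k + 1) * k / 2))) := by
  induction k with
  | zero =>
    obtain ⟨x, hx⟩ := exists_ne (0 : V)
    refine ⟨{x}, ⟨by simpa using hx.symm, ?_⟩, by simp, by simp, ?_⟩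
    · intro y hy z hz c _
      rw [Finset.mem_singleton] at hy hz
      rw [hy, hz]
    · simpa using Finset.card_le_univ (uncovered F {x})
  | succ k ih =>
    obtain ⟨S, hS, hle, hk, hU⟩ := ih
    by_cases h0 : uncovered F S = ∅
    · exact ⟨S, hS, by omega, Or.inl h0, by rw [h0, Finset.card_empty, Nat.cast_zero]; positivity⟩
    have hk := hk.resolve_left h0
    obtain ⟨P, hP⟩ := exists_card_uncovered_insert_le hS
    have hq : 1 < Fintype.card F := Fintype.one_lt_card
    have hUpos : 0 < (uncovered F S).card := Finset.card_pos.2 (Finset.nonempty_iff_ne_empty.2 h0)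
    have hVpos : 0 < Fintype.card V := Fintype.card_pos
    -- Zero or a multiple of an old member would cover nothing new, whereas the averaging bound
    -- guarantees a positive gain.
    have hnew : ∀ x ∈ insert 0 S, ∀ c : F, c • x ≠ P := by
      rintro x hx c rfl
      have hsub : uncovered F S ⊆ uncovered F (insert (c • x) S) := by
        intro Q hQ
        rw [mem_uncovered] at hQ ⊢
        rintro ⟨y, hy, z, hz, a, b, rfl⟩
        obtain ⟨s, hs⟩ : S.Nonempty := Finset.card_pos.1 (by omega)
        have hmul : ∀ y ∈ insert (c • x) S, ∃ y' ∈ S, ∃ d : F, y = d • y' := by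
          intro y hy
          rw [Finset.mem_insert] at hx hy
          rcases hy with rfl | hy
          · rcases hx with rfl | hx
            · exact ⟨s, hs, 0, by simp⟩
            · exact ⟨x, hx, c, rfl⟩
          · exact ⟨y, hy, 1, by simp⟩
        obtain ⟨y', hy', d, rfl⟩ := hmul y hy
        obtain ⟨z', hz', d', rfl⟩ := hmul z hz
        exact hQ ⟨y', hy', z', hz', a * d, b * d', by rw [mul_smul, mul_smul]⟩
      have h1 := Nat.mul_le_mul_left (Fintype.card V) (Finset.card_le_card hsub)
      have h2 : 0 < (uncovered F S).card * ((Fintype.card F - 1) ^ 2 * S.card) := by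
        have : 0 < Fintype.card F - 1 := by omega
        have : 0 < S.card := by omega
        positivity
      omega
    have hP0 : P ≠ 0 := fun h => hnew 0 (Finset.mem_insert_self _ _) 0 (by simp [h])
    have hPS : ∀ x ∈ S, ∀ c : F, c • x ≠ P := fun x hx => hnew x (Finset.mem_insert_of_mem hx)
    have hmem : P ∉ S := fun h => hPS P h 1 (one_smul F P)
    have hcard : (insert P S).card = k + 1 + 1 := by rw [Finset.card_insert_of_notMem hmem, hk]
    refine ⟨insert P S, hS.insert hP0 hPS, hcard.le, Or.inr hcard, ?_⟩
    have hP' : ((uncovered F S).card : ℝ) * (((Fintype.card F : ℝ) - 1) ^ 2 * (k + 1)) +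
        Fintype.card V * (uncovered F (insert P S)).card ≤
          Fintype.card V * (uncovered F S).card := by
      have := hP
      rw [hk] at this
      have h3 : ((Fintype.card F - 1 : ℕ) : ℝ) = (Fintype.card F : ℝ) - 1 := by
        rw [Nat.cast_sub hq.le, Nat.cast_one]
      rw [← h3]
      exact_mod_cast this
    have hV : (0 : ℝ) < Fintype.card V := by exact_mod_cast hVpos
    set c : ℝ := ((Fintype.card F : ℝ) - 1) ^ 2 / Fintype.card V with hc
    have hstep : ((uncovered F (insert P S)).card : ℝ) ≤
        (uncovered F S).card * (1 - c * (k + 1)) := by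
      refine le_of_mul_le_mul_left ?_ hV
      have : (Fintype.card V : ℝ) * ((uncovered F S).card * (1 - c * (k + 1))) =
          Fintype.card V * (uncovered F S).card -
            (uncovered F S).card * (((Fintype.card F : ℝ) - 1) ^ 2 * (k + 1)) := by
        rw [hc]; field_simp
      linarith
    have hexp : 1 - c * (k + 1) ≤ Real.exp (-(c * (k + 1))) := by
      have := Real.add_one_le_exp (-(c * (k + 1)))
      linarith
    -- The step sizes c, 2c, …, (k+1)c sum in the exponent to c(k+2)(k+1)/2.
    calc ((uncovered F (insert P S)).card : ℝ)
        ≤ (uncovered F S).card * Real.exp (-(c * (k + 1))) :=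
          hstep.trans (mul_le_mul_of_nonneg_left hexp (Nat.cast_nonneg _))
      _ ≤ Fintype.card V * Real.exp (-(c * ((k + 1) * k / 2))) * Real.exp (-(c * (k + 1))) :=
          mul_le_mul_of_nonneg_right hU (Real.exp_pos _).le
      _ = _ := by
          rw [mul_assoc, ← Real.exp_add]
          congr 2
          push_cast
          ring

end Greedy

/-! ### Covering the remaining points in pairs -/

section Completion

variable {F V : Type*} [Field F] [AddCommGroup V] [Module F V]

/-- In a plane, one additional point covers any two given uncovered points. -/
theorem exists_isCoveredBy_insert_pair [DecidableEq V] [Module.Finite F V]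
    (hV : Module.finrank F V = 3) {S : Finset V}
    {x y : V} (hx : x ∈ S) (hy : y ∈ S) (hxy : ∀ a b : F, a • x + b • y = 0 → a = 0 ∧ b = 0)
    {A B : V} (hA : ¬ IsCoveredBy F S A) (hB : ¬ IsCoveredBy F S B) :
    ∃ P, IsCoveredBy F (insert P S) A ∧ IsCoveredBy F (insert P S) B := by
  -- A dependency among four vectors in dimension 3 exhibits a common vector of the lines Ax and By,
  -- which serves as P. Its coefficients at A and B are nonzero because neither is covered and x, y
  -- are independent.
  have hdep : ¬ LinearIndependent F ![A, x, B, y] := by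
    intro h
    have := h.fintype_card_le_finrank
    simp [hV] at this
  rw [Fintype.not_linearIndependent_iff] at hdep
  obtain ⟨g, hg, i, hi⟩ := hdep
  simp only [Fin.sum_univ_four, Matrix.cons_val_zero, Matrix.cons_val_one, Matrix.cons_val] at hg
  have hzero : g 0 = 0 → g 2 = 0 → False := by
    intro h0 h2
    rw [h0, h2] at hg
    obtain ⟨h1, h3⟩ := hxy (g 1) (g 3) (by simpa using hg)
    fin_cases i <;> simp_all
  have h2 : g 2 ≠ 0 := by
    intro h2
    have h0 : g 0 ≠ 0 := fun h0 => hzero h0 h2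
    refine hA ((isCoveredBy_smul_iff h0).1 ⟨x, hx, y, hy, -g 1, -g 3, ?_⟩)
    rw [h2] at hg
    rw [← sub_eq_zero, ← neg_eq_zero, ← hg]
    module
  have h0 : g 0 ≠ 0 := by
    intro h0
    refine hB ((isCoveredBy_smul_iff h2).1 ⟨x, hx, y, hy, -g 1, -g 3, ?_⟩)
    rw [h0] at hg
    rw [← sub_eq_zero, ← neg_eq_zero, ← hg]
    module
  refine ⟨g 0 • A + g 1 • x, ?_, ?_⟩
  · refine (isCoveredBy_smul_iff h0).1
      ⟨_, Finset.mem_insert_self _ _, x, Finset.mem_insert_of_mem hx, 1, -g 1, ?_⟩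
    module
  · refine (isCoveredBy_smul_iff h2).1
      ⟨_, Finset.mem_insert_self _ _, y, Finset.mem_insert_of_mem hy, -1, -g 3, ?_⟩
    rw [← sub_eq_zero, ← neg_eq_zero, ← hg]
    module

variable [Fintype F] [DecidableEq F]

theorem card_image_units_smul [DecidableEq V] {A : V} (hA : A ≠ 0) :
    (Finset.univ.image fun c : Fˣ => c • A).card = Fintype.card F - 1 := by
  rw [Finset.card_image_of_injective, Finset.card_univ, Fintype.card_units]
  intro a b h
  exact Units.ext (smul_left_injective F hA h)

/-- The uncovered set is closed under nonzero scaling, so each uncovered point accounts for q - 1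
vectors and the hypothesis allows at most u of them. Each added point removes two, and a last single
one is added itself. -/
theorem exists_isCoveredBy_of_card_uncovered_lt [Fintype V] [DecidableEq V]
    (hV : Module.finrank F V = 3) {x y : V}
    (hxy : ∀ a b : F, a • x + b • y = 0 → a = 0 ∧ b = 0) (u : ℕ) :
    ∀ S : Finset V, x ∈ S → y ∈ S →
      (uncovered F S).card < (Fintype.card F - 1) * (u + 1) →
      ∃ T : Finset V, (∀ v, IsCoveredBy F T v) ∧ T.card ≤ S.card + (u + 1) / 2 := by
  induction u using Nat.strong_induction_on with
  | _ u ih =>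
  intro S hx hy hU
  by_cases hemp : uncovered F S = ∅
  · refine ⟨S, fun v => ?_, by omega⟩
    by_contra hv
    have := mem_uncovered.2 hv
    simp [hemp] at this
  obtain ⟨A, hA⟩ := Finset.nonempty_iff_ne_empty.2 hemp
  have hne : ∀ {Q}, Q ∈ uncovered F S → Q ≠ 0 := by
    rintro Q hQ rfl
    exact mem_uncovered.1 hQ (by simpa using isCoveredBy_smul_of_mem hx (0 : F))
  have hsub : ∀ {Q}, Q ∈ uncovered F S →
      (Finset.univ.image fun c : Fˣ => c • Q) ⊆ uncovered F S := by
    intro Q hQ R hR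
    obtain ⟨c, -, rfl⟩ := Finset.mem_image.1 hR
    rw [mem_uncovered, Units.smul_def, isCoveredBy_smul_iff c.ne_zero]
    exact mem_uncovered.1 hQ
  have hu : 1 ≤ u := by
    have := Finset.card_le_card (hsub hA)
    rw [card_image_units_smul (hne hA)] at this
    by_contra h
    obtain rfl : u = 0 := by omega
    omega
  by_cases hline : ∀ B ∈ uncovered F S, ∃ c : F, c • A = B
  · refine ⟨insert A S, fun v => ?_, (Finset.card_insert_le _ _).trans (by omega)⟩
    by_cases hv : IsCoveredBy F S v
    · exact hv.mono (Finset.subset_insert _ _)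
    · obtain ⟨c, rfl⟩ := hline v (mem_uncovered.2 hv)
      exact isCoveredBy_smul_of_mem (Finset.mem_insert_self _ _) c
  push Not at hline
  obtain ⟨B, hB, hAB⟩ := hline
  obtain ⟨P, hPA, hPB⟩ := exists_isCoveredBy_insert_pair hV hx hy hxy
    (mem_uncovered.1 hA) (mem_uncovered.1 hB)
  have hdisj : Disjoint (Finset.univ.image fun c : Fˣ => c • A)
      (Finset.univ.image fun c : Fˣ => c • B) := by
    rw [Finset.disjoint_left]
    intro R hR hR'
    obtain ⟨c, -, rfl⟩ := Finset.mem_image.1 hR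
    obtain ⟨d, -, hd⟩ := Finset.mem_image.1 hR'
    refine hAB (d⁻¹ * c : Fˣ).1 ?_
    rw [← Units.smul_def, mul_smul, ← hd, inv_smul_smul]
  have hdisj' : Disjoint (uncovered F (insert P S)) ((Finset.univ.image fun c : Fˣ => c • A) ∪
      (Finset.univ.image fun c : Fˣ => c • B)) := by
    rw [Finset.disjoint_right]
    intro R hR
    rw [mem_uncovered, not_not]
    rcases Finset.mem_union.1 hR with hR | hR
    · obtain ⟨c, -, rfl⟩ := Finset.mem_image.1 hR
      exact hPA.smul c.1
    · obtain ⟨c, -, rfl⟩ := Finset.mem_image.1 hR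
      exact hPB.smul c.1
  have hcard : (uncovered F (insert P S)).card + 2 * (Fintype.card F - 1) ≤
      (uncovered F S).card := by
    have h1 : uncovered F (insert P S) ∪ ((Finset.univ.image fun c : Fˣ => c • A) ∪
        (Finset.univ.image fun c : Fˣ => c • B)) ⊆ uncovered F S := by
      refine Finset.union_subset ?_ (Finset.union_subset (hsub hA) (hsub hB))
      intro Q hQ
      rw [mem_uncovered] at hQ ⊢
      exact fun h => hQ (h.mono (Finset.subset_insert _ _))
    have h2 := Finset.card_le_card h1
    rw [Finset.card_union_of_disjoint hdisj', Finset.card_union_of_disjoint hdisj,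
      card_image_units_smul (hne hA), card_image_units_smul (hne hB)] at h2
    omega
  obtain ⟨v, rfl⟩ : ∃ v, u = v + 1 := ⟨u - 1, by omega⟩
  rcases v with _ | v
  · omega
  · obtain ⟨T, hT, hTcard⟩ := ih v (by omega) (insert P S) (Finset.mem_insert_of_mem hx)
      (Finset.mem_insert_of_mem hy) (by
        have : (Fintype.card F - 1) * (v + 1 + 1 + 1) =
          (Fintype.card F - 1) * (v + 1) + 2 * (Fintype.card F - 1) := by ring
        omega)
    refine ⟨T, hT, hTcard.trans ?_⟩
    have := Finset.card_insert_le P S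
    omega

/-- A covering set of `F³` from the greedy construction followed by pairwise completion. -/
theorem exists_isCoveredBy_plane (k u : ℕ) (hk : 1 ≤ k)
    (h : (Fintype.card F : ℝ) ^ 3 *
      Real.exp (-(((Fintype.card F : ℝ) - 1) ^ 2 / (Fintype.card F : ℝ) ^ 3 * ((k + 1) * k / 2))) <
      ((Fintype.card F : ℝ) - 1) * (u + 1)) :
    ∃ T : Finset (Fin 3 → F), (∀ v, IsCoveredBy F T v) ∧ T.card ≤ k + 1 + (u + 1) / 2 := by
  obtain ⟨S, hS, hle, hcard, hU⟩ := exists_card_uncovered_le_mul_exp (F := F) (V := Fin 3 → F) k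
  rcases hcard with h0 | hcard
  · refine ⟨S, fun v => ?_, by omega⟩
    by_contra hv
    have := mem_uncovered.2 hv
    simp [h0] at this
  obtain ⟨x, hx, y, hy, hxy⟩ := Finset.one_lt_card.1 (show 1 < S.card by omega)
  rw [Fintype.card_fun, Fintype.card_fin] at hU
  push_cast at hU
  obtain ⟨T, hT, hTcard⟩ := exists_isCoveredBy_of_card_uncovered_lt (F := F) (V := Fin 3 → F)
    (by simp) (fun a b h => hS.eq_zero_of_smul_add_smul_eq_zero hx hy hxy h) u S hx hy (by
      have h1 := hU.trans_lt h
      have h3 : ((Fintype.card F - 1 : ℕ) : ℝ) = (Fintype.card F : ℝ) - 1 := by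
        rw [Nat.cast_sub Fintype.card_pos, Nat.cast_one]
      rw [← h3] at h1
      exact_mod_cast h1)
  exact ⟨T, hT, by omega⟩

end Completion

/-! ### Numerical estimates for q ≥ 79 -/

section Estimates

/-- The factor `3 ln q + ln ln q + ln (3/4)` under the main square root of `Upsilon`. -/
noncomputable def logFactor (q : ℝ) : ℝ :=
  3 * Real.log q + Real.log (Real.log q) + Real.log (3 / 4)

variable {q : ℝ}

theorem four_lt_log (hq : 79 ≤ q) : 4 < Real.log q := by
  have h2 := Real.log_two_gt_d9
  have h64 : Real.log 64 = 6 * Real.log 2 := by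
    rw [show (64 : ℝ) = 2 ^ 6 by norm_num, Real.log_pow]; norm_num
  have := Real.log_le_log (by norm_num) (show (64 : ℝ) ≤ q by linarith)
  linarith

theorem log_le_mul (hq : 79 ≤ q) : Real.log q ≤ 12 / 100 * q := by
  have h2 := Real.log_two_lt_d9
  have h16 : Real.log 16 = 4 * Real.log 2 := by
    rw [show (16 : ℝ) = 2 ^ 4 by norm_num, Real.log_pow]; norm_num
  -- The tangent to the logarithm at 16, where its value is 4 ln 2.
  have h := Real.log_le_sub_one_of_pos (show 0 < q / 16 by linarith)
  rw [Real.log_div (by linarith) (by norm_num)] at h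
  linarith

theorem twelve_lt_logFactor (hq : 79 ≤ q) : 12 < logFactor q := by
  have h1 := four_lt_log hq
  have h2 : Real.log 2 ≤ Real.log (Real.log q) := Real.log_le_log (by norm_num) (by linarith)
  have h3 := Real.one_sub_inv_le_log_of_pos (show (0 : ℝ) < 3 / 4 by norm_num)
  have h4 := Real.log_two_gt_d9
  unfold logFactor
  norm_num at h3
  linarith

theorem logFactor_le (hq : 79 ≤ q) : logFactor q ≤ 48 / 100 * q := by
  have h1 := four_lt_log hq
  have h2 := Real.log_le_sub_one_of_pos (show 0 < Real.log q by linarith)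
  have h3 := Real.log_le_sub_one_of_pos (show (0 : ℝ) < 3 / 4 by norm_num)
  have h4 := log_le_mul hq
  unfold logFactor
  linarith

/-- `q² exp(-L/2)` is the number of points left to the completion phase. -/
theorem sq_mul_exp_neg_logFactor (hq : 79 ≤ q) :
    q ^ 2 * Real.exp (-(logFactor q / 2)) = 2 * Real.sqrt (q / (3 * Real.log q)) := by
  have hlog := four_lt_log hq
  have hq0 : 0 < q := by linarith
  have hl0 : 0 < Real.log q := by linarith
  have hexp : Real.exp (logFactor q) = q ^ 3 * Real.log q * (3 / 4) := by
    unfold logFactor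
    rw [Real.exp_add, Real.exp_add, Real.exp_log hl0, Real.exp_log (by norm_num : (0 : ℝ) < 3 / 4),
      show 3 * Real.log q = Real.log q + Real.log q + Real.log q by ring, Real.exp_add,
      Real.exp_add, Real.exp_log hq0]
    ring
  rw [← sq_eq_sq₀ (by positivity) (by positivity), mul_pow, mul_pow,
    Real.sq_sqrt (by positivity), ← Real.exp_nat_mul,
    show ((2 : ℕ) : ℝ) * -(logFactor q / 2) = -logFactor q by push_cast; ring, Real.exp_neg, hexp]
  field_simp
  norm_num

/-- Makes the linear part of K² + K outweigh the loss from replacing q by q - 1 in the greedy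
exponent. -/
theorem mul_logFactor_le_sqrt (hq : 79 ≤ q) :
    14 / 10 * logFactor q ≤ Real.sqrt ((q + 1) * logFactor q) := by
  have h1 := twelve_lt_logFactor hq
  have h2 := logFactor_le hq
  refine Real.le_sqrt_of_sq_le ?_
  nlinarith

/-- The exponent reached after `κ` greedy steps. -/
theorem logFactor_half_add_le {κ : ℝ} (hq : 79 ≤ q)
    (hκ : Real.sqrt ((q + 1) * logFactor q) ≤ κ) :
    logFactor q / 2 + 1 / (q - 1) ≤ (q - 1) ^ 2 / q ^ 3 * ((κ + 1) * κ / 2) := by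
  set L := logFactor q with hL
  set K := Real.sqrt ((q + 1) * L) with hK
  have h1 : 12 < L := twelve_lt_logFactor hq
  have h3 : 14 / 10 * L ≤ K := mul_logFactor_le_sqrt hq
  have hK2 : K ^ 2 = (q + 1) * L := Real.sq_sqrt (by nlinarith)
  have hK0 : 0 ≤ K := Real.sqrt_nonneg _
  have hmono : (K + 1) * K / 2 ≤ (κ + 1) * κ / 2 := by nlinarith
  refine le_trans ?_ (mul_le_mul_of_nonneg_left hmono (by positivity))
  have hq0 : 0 < q := by linarith
  have hinv : q * (1 / (q - 1)) ≤ 102 / 100 := by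
    rw [mul_one_div, div_le_iff₀ (by linarith)]
    linarith
  have hc : q * ((q - 1) ^ 2 / q ^ 3) = (q - 1) ^ 2 / q ^ 2 := by field_simp
  have hc1 : 97 / 100 ≤ (q - 1) ^ 2 / q ^ 2 := by
    rw [le_div_iff₀ (by positivity)]
    nlinarith
  have hc2 : q - 102 / 100 ≤ (q - 1) ^ 2 / q ^ 2 * (q + 1) := by
    rw [div_mul_eq_mul_div, le_div_iff₀ (by positivity)]
    nlinarith
  refine le_of_mul_le_mul_left ?_ hq0
  have hrhs : q * ((q - 1) ^ 2 / q ^ 3 * ((K + 1) * K / 2)) =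
      ((q - 1) ^ 2 / q ^ 2 * (q + 1) * L + (q - 1) ^ 2 / q ^ 2 * K) / 2 := by
    rw [← mul_assoc, hc, show (K + 1) * K = K ^ 2 + K by ring, hK2]
    ring
  rw [hrhs, mul_add]
  -- The quadratic part loses at most 1.02 L against qL, while the linear part gains 0.97 K ≥ 1.358
  -- L. The surplus, above 0.33 L with L > 12, exceeds the required 2.04.
  have h4 := mul_le_mul_of_nonneg_right hc2 (show 0 ≤ L by linarith)
  have h5 := mul_le_mul_of_nonneg_right hc1 hK0
  nlinarith

/-- Ensures that the plane set is small enough to be labelled by distinct field elements. -/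
theorem Upsilon_le (hq : 79 ≤ q) : Upsilon q ≤ q := by
  have h1 := logFactor_le hq
  have h2 := twelve_lt_logFactor hq
  have h3 := four_lt_log hq
  have hK : Real.sqrt ((q + 1) * logFactor q) ≤ 72 / 100 * q := by
    refine Real.sqrt_le_iff.2 ⟨by linarith, ?_⟩
    nlinarith
  have hs : Real.sqrt (q / (3 * Real.log q)) ≤ 8 / 100 * q := by
    refine Real.sqrt_le_iff.2 ⟨by linarith, ?_⟩
    rw [div_le_iff₀ (by linarith)]
    nlinarith
  have : Upsilon q = Real.sqrt ((q + 1) * logFactor q) + Real.sqrt (q / (3 * Real.log q)) + 3 := rfl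
  linarith

end Estimates

/-! ### Assembling the bound -/

section Main

variable {F : Type*} [Field F] [Fintype F]

/-- The plane bound, with half a point to spare. -/
theorem exists_isCoveredBy_plane_card_le [DecidableEq F] (hq : 79 ≤ Fintype.card F) :
    ∃ T : Finset (Fin 3 → F), (∀ v, IsCoveredBy F T v) ∧
      (T.card : ℝ) ≤ Upsilon (Fintype.card F) - 1 / 2 := by
  set q : ℝ := (Fintype.card F : ℝ) with hqdef
  have hq' : (79 : ℝ) ≤ q := by rw [hqdef]; exact_mod_cast hq
  have hL := twelve_lt_logFactor hq'
  set K := Real.sqrt ((q + 1) * logFactor q) with hK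
  set η := Real.sqrt (q / (3 * Real.log q)) with hη
  have hη0 : 0 ≤ η := Real.sqrt_nonneg _
  have hK0 : 0 < K := Real.sqrt_pos.2 (by nlinarith)
  obtain ⟨T, hT, hcard⟩ := exists_isCoveredBy_plane (F := F) ⌈K⌉₊ ⌊2 * η⌋₊
    (Nat.one_le_iff_ne_zero.2 (Nat.ceil_pos.2 hK0).ne') (by
      rw [← hqdef]
      have h1 := logFactor_half_add_le hq' (Nat.le_ceil K)
      have h2 := Nat.lt_floor_add_one (2 * η)
      -- The extra 1/(q-1) in the exponent trades a factor q for q - 1, the number of vectors per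
      -- projective point.
      have h3 : q * Real.exp (-(1 / (q - 1))) ≤ q - 1 := by
        rw [Real.exp_neg, ← div_eq_mul_inv, div_le_iff₀ (Real.exp_pos _)]
        have h4 := Real.add_one_le_exp (1 / (q - 1))
        have h5 : (q - 1) * (1 / (q - 1) + 1) = q := by
          have : q - 1 ≠ 0 := by linarith
          field_simp
          ring
        nlinarith
      calc q ^ 3 * Real.exp (-((q - 1) ^ 2 / q ^ 3 * ((⌈K⌉₊ + 1) * ⌈K⌉₊ / 2)))
          ≤ q ^ 3 * Real.exp (-(logFactor q / 2 + 1 / (q - 1))) := by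
            gcongr
        _ = (q * Real.exp (-(1 / (q - 1)))) * (q ^ 2 * Real.exp (-(logFactor q / 2))) := by
            rw [neg_add, Real.exp_add]
            ring
        _ ≤ (q - 1) * (2 * η) := by
            rw [sq_mul_exp_neg_logFactor hq']
            exact mul_le_mul_of_nonneg_right h3 (by positivity)
        _ < (q - 1) * (⌊2 * η⌋₊ + 1) := by
            exact mul_lt_mul_of_pos_left h2 (by linarith))
  refine ⟨T, hT, ?_⟩
  -- The ceiling costs less than 1, the initial point 1, and pairing at most η + 1/2, giving K + η +
  -- 5/2.
  have h1 : (T.card : ℝ) ≤ ⌈K⌉₊ + 1 + (⌊2 * η⌋₊ + 1) / 2 := by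
    have h2 : ((T.card : ℕ) : ℝ) ≤ ((⌈K⌉₊ + 1 + (⌊2 * η⌋₊ + 1) / 2 : ℕ) : ℝ) := by
      exact_mod_cast hcard
    have h3 : (((⌊2 * η⌋₊ + 1) / 2 : ℕ) : ℝ) ≤ ((⌊2 * η⌋₊ + 1 : ℕ) : ℝ) / 2 := by
      exact_mod_cast Nat.cast_div_le (α := ℝ) (m := ⌊2 * η⌋₊ + 1) (n := 2)
    push_cast at h2 h3
    linarith
  have h2 := Nat.ceil_lt_add_one hK0.le
  have h3 := Nat.floor_le (show 0 ≤ 2 * η by positivity)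
  have : Upsilon q = K + η + 3 := rfl
  linarith

/-- The spare half point in the plane is worth q^m/2 after lifting. Since q - 1 ≥ 4, this absorbs
both families of coordinate points. -/
theorem saturatingNumber_le_Upsilon_mul_pow (hq : 79 ≤ Fintype.card F) {N m : ℕ}
    (hN : N = 2 * m + 2) :
    (saturatingNumber N F : ℝ) ≤ Upsilon (Fintype.card F) * (Fintype.card F : ℝ) ^ m := by
  classical
  obtain ⟨T, hT, hcard⟩ := exists_isCoveredBy_plane_card_le (F := F) hq
  have hq' : (79 : ℝ) ≤ Fintype.card F := by exact_mod_cast hq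
  have hle : T.card ≤ Nat.card F := by
    rw [Nat.card_eq_fintype_card]
    have := Upsilon_le hq'
    have h : (T.card : ℝ) ≤ Fintype.card F := by linarith
    exact_mod_cast h
  have h1 := saturatingNumber_le_of_plane hT hle hN
  have h2 := Projectivization.card' F (Fin m → F)
  rw [Nat.card_fun, Nat.card_eq_fintype_card (α := Fin m), Fintype.card_fin,
    Nat.card_eq_fintype_card (α := F)] at h2
  rw [Nat.card_eq_fintype_card (α := F)] at h1
  set p := Nat.card (ℙ F (Fin m → F))
  have h3 : (p : ℝ) * 4 ≤ (Fintype.card F : ℝ) ^ m := by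
    have : p * 4 ≤ p * (Fintype.card F - 1) := Nat.mul_le_mul_left _ (by omega)
    have h : p * 4 ≤ Fintype.card F ^ m := by omega
    exact_mod_cast h
  have h4 : (saturatingNumber N F : ℝ) ≤ T.card * (Fintype.card F : ℝ) ^ m + 2 * p := by
    exact_mod_cast h1
  have h5 := mul_le_mul_of_nonneg_right hcard (show 0 ≤ (Fintype.card F : ℝ) ^ m by positivity)
  linarith

end Main

theorem corollary3 {F : Type*} [Field F] [Fintype F] [DecidableEq F]
    (q : ℕ) (hF : Fintype.card F = q) (hq : 79 ≤ q) :
    (∀ N : ℕ, Even N → 4 ≤ N → N ≠ 8 → N ≠ 12 →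
      saturatingNumber N F = lengthFunction 2 (N + 1) F ∧
      (lengthFunction 2 (N + 1) F : ℝ) ≤
        Upsilon (q : ℝ) * (q : ℝ) ^ ((N - 2) / 2) + 2 * (q : ℝ) ^ ((N - 4) / 2)) ∧
    (∀ N : ℕ, N = 8 ∨ N = 12 →
      saturatingNumber N F = lengthFunction 2 (N + 1) F ∧
      (lengthFunction 2 (N + 1) F : ℝ) ≤
        Upsilon (q : ℝ) * (q : ℝ) ^ ((N - 2) / 2) + 2 * (q : ℝ) ^ ((N - 4) / 2)
          + (q : ℝ) ^ ((N - 6) / 2) + (q : ℝ) ^ ((N - 8) / 2)) := by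
  subst hF
  -- N = 8 and N = 12 are not exceptional for this construction; part (ii) only adds nonnegative
  -- terms.
  have key : ∀ N : ℕ, Even N → 4 ≤ N →
      saturatingNumber N F = lengthFunction 2 (N + 1) F ∧
      (lengthFunction 2 (N + 1) F : ℝ) ≤ Upsilon (Fintype.card F : ℝ) *
        (Fintype.card F : ℝ) ^ ((N - 2) / 2) + 2 * (Fintype.card F : ℝ) ^ ((N - 4) / 2) := by
    intro N hN h4
    have heq := saturatingNumber_eq_lengthFunction (F := F) (N := N) (by omega)
    refine ⟨heq, ?_⟩
    rw [← heq]
    obtain ⟨r, hr⟩ := hN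
    have := saturatingNumber_le_Upsilon_mul_pow (F := F) (N := N) (m := (N - 2) / 2) hq (by omega)
    exact this.trans (le_add_of_nonneg_right (by positivity))
  refine ⟨fun N hN h4 _ _ => key N hN h4, fun N hN => ?_⟩
  obtain ⟨heq, hle⟩ := key N (by rcases hN with rfl | rfl <;> decide) (by omega)
  refine ⟨heq, hle.trans ?_⟩
  rw [add_assoc _ ((Fintype.card F : ℝ) ^ ((N - 6) / 2))]
  exact le_add_of_nonneg_right (by positivity)
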